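/- Let $\Theta$ be a variety of algebras (the class of all algebras of a finitary signature without relation symbols, possibly with constants, that satisfy a given set of identities), let $X^0$ be an infinite set of variables, $X\subset X^0$ a finite subset, $W(Z)$ the free algebra of $\Theta$ over $Z$, and let $H\in\Theta$ be a nonempty algebra. A point is a homomorphism $\mu:W(X)\to H$. For finite $Y\subset X^0$ let $\Phi(Y)$ be the domain of sort $Y$ of the multi-sorted algebra of formulas: pure formulas of the sorts $Y$ are built from equalities $w\equiv w'$ ($w,w'\in W(Y)$) by Boolean operations, quantifiers $\exists x$ ($x\in Y$) and the operations $s_*$ from formulas of sort $Y$ to formulas of sort $Z$, one for each homomorphism $s:W(Y)\to W(Z)$; they are taken modulo the congruence generated by the identities of Halmos algebras. Satisfaction on points is defined by: $\mu$ satisfies $w\equiv w'$ iff $\mu(w)=\mu(w')$; $\mu$ satisfies $\exists x\,u$ iff some point $\nu$ that coincides with $\mu$ on all variables other than $x$ satisfies $u$; $\mu$ satisfies $s_*u$ iff $\mu s$ satisfies $u$; Boolean operations as usual. Write $LKer(\mu)\subseteq\Phi(X)$ for the set of formulas satisfied by $\mu$. A set $A\subseteq Hom(W(X),H)$ is $LG$-definable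 if $A=T^L_H=\{\mu: T\subseteq LKer(\mu)\}$ for some $T\subseteq\Phi(X)$. Let $\Phi(X^0)$ be the Lindenbaum--Tarski algebra of first-order formulas with equalities $w\equiv w'$, $w,w'\in W(X^0)$, over $\Theta$. A formula is $X$-special if all its free variables lie in $X$ and all its bound variables lie in $X^0\setminus X$; an element of $\Phi(X^0)$ is $X$-special if it is represented by such a formula. $Tp^H(\mu)$ is the set of all $X$-special $u$ which are satisfied in $H$ when each $x\in X$ is given the value $\mu(x)$. An $X$-type is a set of $X$-special formulas consistent with the elementary theory of $H$. A set $A\subseteq Hom(W(X),H)$ is $MT$-definable if $A=T^{L_0}_H=\{\mu: T\subseteq Tp^H(\mu)\}$ for some $X$-type $T$. **Theorem.** Let $A\subseteq Hom(W(X),H)$. If $A$ is $MT$-definable, then $A$ is $LG$-definable. If $A$ is nonempty and $LG$-definable, then $A$ is $MT$-definable. In particular, a nonempty set $A$ is $LG$-definable if and only if it is $MT$-definable. -/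

import Mathlib

open FirstOrder

universe u u' v w

namespace LogicalGeometry

section Varieties

/-- A system of identities (pairs of terms in countably many variables).  It determines the
variety `Θ` of all algebras of the signature `L` in which the identities hold.  The signature
`L` is a first-order language without relation symbols; constants are `0`-ary operations. -/
abbrev Identities (L : FirstOrder.Language.{u, u'}) := Set (L.Term ℕ × L.Term ℕ)

/-- The algebra `H` belongs to the variety `Θ` determined by the identities `E`. -/
class InVariety {L : FirstOrder.Language.{u, u'}} (E : Identities L) (H : Type w) [L.Structure H] :
    Prop where
  sat : ∀ p ∈ E, ∀ a : ℕ → H, p.1.realize a = p.2.realize a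

/-- The least congruence on terms that contains all substitution instances of the identities. -/
inductive TermCongr {L : FirstOrder.Language.{u, u'}} (E : Identities L) (α : Type v) :
    L.Term α → L.Term α → Prop
  | ident (p : L.Term ℕ × L.Term ℕ) (hp : p ∈ E) (σ : ℕ → L.Term α) :
      TermCongr E α (p.1.subst σ) (p.2.subst σ)
  | refl (t) : TermCongr E α t t
  | symm {t t'} : TermCongr E α t t' → TermCongr E α t' t
  | trans {t t' t''} : TermCongr E α t t' → TermCongr E α t' t'' → TermCongr E α t t''
  | func {n : ℕ} (f : L.Functions n) (t t' : Fin n → L.Term α) :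
      (∀ i, TermCongr E α (t i) (t' i)) →
      TermCongr E α (FirstOrder.Language.Term.func f t) (FirstOrder.Language.Term.func f t')

/-- The congruence of `TermCongr` as a setoid. -/
def termSetoid {L : FirstOrder.Language.{u, u'}} (E : Identities L) (α : Type v) : Setoid (L.Term α) :=
  ⟨TermCongr E α, TermCongr.refl, TermCongr.symm, TermCongr.trans⟩

/-- The algebra `W(α)`, free in the variety `Θ` over the set of variables `α`. -/
def Free {L : FirstOrder.Language.{u, u'}} (E : Identities L) (α : Type v) : Type (max u v) :=
  Quotient (termSetoid E α)

/-- The element of the free algebra represented by a term. -/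
def Free.mk {L : FirstOrder.Language.{u, u'}} (E : Identities L) {α : Type v} (t : L.Term α) : Free E α :=
  Quotient.mk (termSetoid E α) t

/-- The variables (free generators) in the free algebra. -/
def Free.var {L : FirstOrder.Language.{u, u'}} (E : Identities L) {α : Type v} (x : α) : Free E α :=
  Free.mk E (FirstOrder.Language.Term.var x)

noncomputable instance Free.structure {L : FirstOrder.Language.{u, u'}} [L.IsAlgebraic] (E : Identities L)
    (α : Type v) : L.Structure (Free E α) where
  funMap f a := Free.mk E (FirstOrder.Language.Term.func f fun i => Quotient.out (a i))
  RelMap r := isEmptyElim r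

theorem Free.funMap_mk {L : FirstOrder.Language.{u, u'}} [L.IsAlgebraic] (E : Identities L) {α : Type v}
    {n : ℕ} (f : L.Functions n) (t : Fin n → L.Term α) :
    FirstOrder.Language.Structure.funMap f (fun i => Free.mk E (t i)) =
      Free.mk E (FirstOrder.Language.Term.func f t) :=
  Quotient.sound (s := termSetoid E α)
    (TermCongr.func f _ _ fun i => Quotient.mk_out (s := termSetoid E α) (t i))

theorem TermCongr.realize_eq {L : FirstOrder.Language.{u, u'}} {E : Identities L} {α : Type v} {H : Type w}
    [L.Structure H] [InVariety E H] (a : α → H) {t t' : L.Term α} (h : TermCongr E α t t') :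
    t.realize a = t'.realize a := by
  induction h with
  | ident p hp σ =>
    rw [FirstOrder.Language.Term.realize_subst, FirstOrder.Language.Term.realize_subst]
    exact InVariety.sat p hp _
  | refl t => rfl
  | symm _ ih => exact ih.symm
  | trans _ _ ih ih' => exact ih.trans ih'
  | func f t t' _ ih =>
    rw [FirstOrder.Language.Term.realize_func, FirstOrder.Language.Term.realize_func]
    exact congrArg _ (funext ih)

/-- The affine space `Hom(W(α), H)`; its elements are the points `μ : W(α) → H`. -/
abbrev Point {L : FirstOrder.Language.{u, u'}} [L.IsAlgebraic] (E : Identities L) (α : Type v) (H : Type w)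
    [L.Structure H] := Free E α →[L] H

/-- The homomorphism `W(α) → H` that extends a given map of the variables. -/
def Point.lift {L : FirstOrder.Language.{u, u'}} [L.IsAlgebraic] (E : Identities L) {α : Type v}
    {H : Type w} [L.Structure H] [InVariety E H] (a : α → H) : Point E α H where
  toFun := Quotient.lift (fun t : L.Term α => t.realize a) fun _ _ h =>
    TermCongr.realize_eq (E := E) a h
  map_fun' := by
    intro n f x
    have hx : x = fun i => Free.mk E (Quotient.out (x i)) :=
      funext fun i => (Quotient.out_eq (x i)).symm
    rw [hx, Free.funMap_mk]
    rfl
  map_rel' := fun r => isEmptyElim r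

theorem Point.lift_var {L : FirstOrder.Language.{u, u'}} [L.IsAlgebraic] (E : Identities L) {α : Type v}
    {H : Type w} [L.Structure H] [InVariety E H] (a : α → H) (x : α) :
    Point.lift E a (Free.var E x) = a x := rfl

/-- Two points agree on every subalgebra whose generating variables they agree on. -/
theorem Point.eqOn_closure {L : FirstOrder.Language.{u, u'}} [L.IsAlgebraic] {E : Identities L} {α : Type v}
    {H : Type w} [L.Structure H] {μ ν : Point E α H} {S : Set α}
    (h : ∀ x ∈ S, μ (Free.var E x) = ν (Free.var E x)) {a : Free E α}
    (ha : a ∈ FirstOrder.Language.Substructure.closure L (Free.var E '' S)) : μ a = ν a := by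
  have hs : Set.EqOn μ ν (Free.var E '' S) := by
    rintro _ ⟨x, hx, rfl⟩
    exact h x hx
  exact FirstOrder.Language.Hom.eqOn_closure hs ha

theorem Point.ext_var {L : FirstOrder.Language.{u, u'}} [L.IsAlgebraic] {E : Identities L} {α : Type v}
    {H : Type w} [L.Structure H] {μ ν : Point E α H}
    (h : ∀ x, μ (Free.var E x) = ν (Free.var E x)) : μ = ν := by
  apply FirstOrder.Language.Hom.ext
  intro a
  obtain ⟨t, rfl⟩ : ∃ t, Free.mk E t = a := Quotient.exists_rep a
  induction t with
  | var x => exact h x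
  | func f t ih =>
    rw [← Free.funMap_mk, FirstOrder.Language.Hom.map_fun, FirstOrder.Language.Hom.map_fun]
    exact congrArg _ (funext ih)

end Varieties

section Semantics

/-- The quantifier `∃x` on sets of points: `μ ∈ ∃x A` iff some `ν ∈ A` coincides with `μ` on all
variables different from `x`. -/
def cyl {L : FirstOrder.Language.{u, u'}} [L.IsAlgebraic] {E : Identities L} {α : Type v} {H : Type w}
    [L.Structure H] (x : α) (A : Set (Point E α H)) : Set (Point E α H) :=
  {μ | ∃ ν ∈ A, ∀ x', x' ≠ x → μ (Free.var E x') = ν (Free.var E x')}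

/-- The set of points `[w ≡ w']_H`. -/
def eqSet {L : FirstOrder.Language.{u, u'}} [L.IsAlgebraic] {E : Identities L} {α : Type v} (H : Type w)
    [L.Structure H] (a b : Free E α) : Set (Point E α H) :=
  {μ | μ a = μ b}

/-- The operation `s_*` on sets of points, for `s : W(α) → W(β)`: `μ ∈ s_* A` iff `μ s ∈ A`. -/
def push {L : FirstOrder.Language.{u, u'}} [L.IsAlgebraic] {E : Identities L} {α β : Type v} {H : Type w}
    [L.Structure H] (s : Free E α →[L] Free E β) (A : Set (Point E α H)) :
    Set (Point E β H) :=
  {μ | FirstOrder.Language.Hom.comp μ s ∈ A}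

end Semantics

section MultiSorted

/-- The absolutely free multi-sorted algebra of pure formulas, in the signature of Halmos
algebras.  The sorts are the finite subsets `X` of the infinite set of variables `V`; `HForm E X`
is the domain of the sort `X`.  The operations are the Boolean ones, the quantifiers `∃x` with
`x ∈ X`, the equalities `a ≡ b` with `a, b ∈ W(X)` as constants, and `s_*` for every homomorphism
`s : W(X) → W(Y)`. -/
inductive HForm {L : FirstOrder.Language.{u, u'}} [L.IsAlgebraic] (E : Identities L) {V : Type v} :
    Finset V → Type (max u v)
  | eq {X : Finset V} (a b : Free E X) : HForm E X
  | top {X : Finset V} : HForm E X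
  | bot {X : Finset V} : HForm E X
  | neg {X : Finset V} (p : HForm E X) : HForm E X
  | inf {X : Finset V} (p q : HForm E X) : HForm E X
  | sup {X : Finset V} (p q : HForm E X) : HForm E X
  | ex {X : Finset V} (x : X) (p : HForm E X) : HForm E X
  | sub {X Y : Finset V} (s : Free E X →[L] Free E Y) (p : HForm E X) : HForm E Y

/-- Finite meets of formulas. -/
def HForm.infs {L : FirstOrder.Language.{u, u'}} [L.IsAlgebraic] {E : Identities L} {V : Type v}
    {X : Finset V} : List (HForm E X) → HForm E X
  | [] => HForm.top
  | p :: l => HForm.inf p (HForm.infs l)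

/-- The verbal congruence of the variety of Halmos algebras on the algebra of pure formulas:
the least congruence of the multi-sorted algebra that contains all instances of the identities
of Halmos algebras.  An inequality `p ≤ q` is written as `p ∧ q = p`. -/
inductive HalEq {L : FirstOrder.Language.{u, u'}} [L.IsAlgebraic] (E : Identities L) {V : Type v} :
    ∀ {X : Finset V}, HForm E X → HForm E X → Prop
  /- equivalence relation compatible with the operations -/
  | refl {X : Finset V} (p : HForm E X) : HalEq E p p
  | symm {X : Finset V} {p q : HForm E X} : HalEq E p q → HalEq E q p
  | trans {X : Finset V} {p q r : HForm E X} : HalEq E p q → HalEq E q r → HalEq E p r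
  | neg {X : Finset V} {p q : HForm E X} : HalEq E p q → HalEq E (.neg p) (.neg q)
  | inf {X : Finset V} {p p' q q' : HForm E X} : HalEq E p p' → HalEq E q q' →
      HalEq E (.inf p q) (.inf p' q')
  | sup {X : Finset V} {p p' q q' : HForm E X} : HalEq E p p' → HalEq E q q' →
      HalEq E (.sup p q) (.sup p' q')
  | ex {X : Finset V} (x : X) {p q : HForm E X} : HalEq E p q → HalEq E (.ex x p) (.ex x q)
  | sub {X Y : Finset V} (s : Free E X →[L] Free E Y) {p q : HForm E X} : HalEq E p q →
      HalEq E (.sub s p) (.sub s q)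
  /- Boolean algebras -/
  | inf_comm {X : Finset V} (p q : HForm E X) : HalEq E (.inf p q) (.inf q p)
  | sup_comm {X : Finset V} (p q : HForm E X) : HalEq E (.sup p q) (.sup q p)
  | inf_assoc {X : Finset V} (p q r : HForm E X) :
      HalEq E (.inf (.inf p q) r) (.inf p (.inf q r))
  | sup_assoc {X : Finset V} (p q r : HForm E X) :
      HalEq E (.sup (.sup p q) r) (.sup p (.sup q r))
  | inf_sup_self {X : Finset V} (p q : HForm E X) : HalEq E (.inf p (.sup p q)) p
  | sup_inf_self {X : Finset V} (p q : HForm E X) : HalEq E (.sup p (.inf p q)) p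
  | inf_sup_distrib {X : Finset V} (p q r : HForm E X) :
      HalEq E (.inf p (.sup q r)) (.sup (.inf p q) (.inf p r))
  | inf_neg {X : Finset V} (p : HForm E X) : HalEq E (.inf p (.neg p)) .bot
  | sup_neg {X : Finset V} (p : HForm E X) : HalEq E (.sup p (.neg p)) .top
  /- existential quantifiers -/
  | ex_bot {X : Finset V} (x : X) : HalEq E (.ex x .bot) .bot
  | le_ex {X : Finset V} (x : X) (p : HForm E X) : HalEq E (.inf p (.ex x p)) p
  | ex_inf_ex {X : Finset V} (x : X) (p q : HForm E X) :
      HalEq E (.ex x (.inf p (.ex x q))) (.inf (.ex x p) (.ex x q))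
  | ex_comm {X : Finset V} (x y : X) (p : HForm E X) :
      HalEq E (.ex x (.ex y p)) (.ex y (.ex x p))
  /- equalities -/
  | eq_refl {X : Finset V} (a : Free E X) : HalEq E (.eq a a) .top
  | eq_symm {X : Finset V} (a b : Free E X) : HalEq E (.eq a b) (.eq b a)
  | eq_trans {X : Finset V} (a b c : Free E X) :
      HalEq E (.inf (.inf (.eq a b) (.eq b c)) (.eq a c)) (.inf (.eq a b) (.eq b c))
  | eq_funMap {X : Finset V} {n : ℕ} (f : L.Functions n) (a b : Fin n → Free E X) :
      HalEq E
        (.inf (HForm.infs (List.ofFn fun i => .eq (a i) (b i)))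
          (.eq (FirstOrder.Language.Structure.funMap f a) (FirstOrder.Language.Structure.funMap f b)))
        (HForm.infs (List.ofFn fun i => .eq (a i) (b i)))
  /- every `s_*` is a Boolean homomorphism, and `s ↦ s_*` is a functor -/
  | sub_top {X Y : Finset V} (s : Free E X →[L] Free E Y) : HalEq E (.sub s .top) .top
  | sub_bot {X Y : Finset V} (s : Free E X →[L] Free E Y) : HalEq E (.sub s .bot) .bot
  | sub_neg {X Y : Finset V} (s : Free E X →[L] Free E Y) (p : HForm E X) :
      HalEq E (.sub s (.neg p)) (.neg (.sub s p))
  | sub_inf {X Y : Finset V} (s : Free E X →[L] Free E Y) (p q : HForm E X) :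
      HalEq E (.sub s (.inf p q)) (.inf (.sub s p) (.sub s q))
  | sub_sup {X Y : Finset V} (s : Free E X →[L] Free E Y) (p q : HForm E X) :
      HalEq E (.sub s (.sup p q)) (.sup (.sub s p) (.sub s q))
  | sub_id {X : Finset V} (p : HForm E X) : HalEq E (.sub (FirstOrder.Language.Hom.id L _) p) p
  | sub_sub {X Y Z : Finset V} (s : Free E X →[L] Free E Y) (t : Free E Y →[L] Free E Z)
      (p : HForm E X) : HalEq E (.sub t (.sub s p)) (.sub (FirstOrder.Language.Hom.comp t s) p)
  /- `s_*` and quantifiers: if `s` and `t` coincide on all variables except `x`, then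
  `s_* ∃x p = t_* ∃x p`; if `s x = y` is a variable which does not occur in `s x'` for the
  variables `x' ≠ x`, then `s_* ∃x p = ∃y s_* p` -/
  | sub_ex_congr {X Y : Finset V} (s t : Free E X →[L] Free E Y) (x : X) (p : HForm E X) :
      (∀ x', x' ≠ x → s (Free.var E x') = t (Free.var E x')) →
      HalEq E (.sub s (.ex x p)) (.sub t (.ex x p))
  | sub_ex {X Y : Finset V} (s : Free E X →[L] Free E Y) (x : X) (y : Y) (p : HForm E X) :
      s (Free.var E x) = Free.var E y →
      (∀ x', x' ≠ x → s (Free.var E x') ∈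
        FirstOrder.Language.Substructure.closure L (Free.var E '' {y' : Y | y' ≠ y})) →
      HalEq E (.sub s (.ex x p)) (.ex y (.sub s p))
  /- `s_*` and equalities; below, `s` and `t` are the substitutions of `a` and `b` for `x` -/
  | sub_eq {X Y : Finset V} (s : Free E X →[L] Free E Y) (a b : Free E X) :
      HalEq E (.sub s (.eq a b)) (.eq (s a) (s b))
  | sub_inf_eq {X : Finset V} (s t : Free E X →[L] Free E X) (x : X) (a b : Free E X)
      (p : HForm E X) :
      s (Free.var E x) = a → t (Free.var E x) = b →
      (∀ x', x' ≠ x → s (Free.var E x') = Free.var E x' ∧ t (Free.var E x') = Free.var E x') →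
      HalEq E (.inf (.inf (.sub s p) (.eq a b)) (.sub t p)) (.inf (.sub s p) (.eq a b))

/-- The value of a pure formula in the algebra `Hal_Θ(H)` of sets of points. -/
def HForm.val {L : FirstOrder.Language.{u, u'}} [L.IsAlgebraic] {E : Identities L} {V : Type v} (H : Type w)
    [L.Structure H] : ∀ {X : Finset V}, HForm E X → Set (Point E X H)
  | _, .eq a b => eqSet H a b
  | _, .top => Set.univ
  | _, .bot => ∅
  | _, .neg p => (p.val H)ᶜ
  | _, .inf p q => p.val H ∩ q.val H
  | _, .sup p q => p.val H ∪ q.val H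
  | _, .ex x p => cyl x (p.val H)
  | _, .sub s p => push s (p.val H)

theorem HForm.mem_val_infs {L : FirstOrder.Language.{u, u'}} [L.IsAlgebraic] {E : Identities L} {V : Type v}
    (H : Type w) [L.Structure H] {X : Finset V} (l : List (HForm E X)) (μ : Point E X H) :
    μ ∈ (HForm.infs l).val H ↔ ∀ p ∈ l, μ ∈ p.val H := by
  induction l with
  | nil => simp [HForm.infs, HForm.val]
  | cons p l ih => simp [HForm.infs, HForm.val, ih]

/-- `Hal_Θ(H)` satisfies the identities of Halmos algebras. -/
theorem HalEq.val_eq {L : FirstOrder.Language.{u, u'}} [L.IsAlgebraic] {E : Identities L} {V : Type v}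
    (H : Type w) [L.Structure H] [InVariety E H] {X : Finset V} {p q : HForm E X}
    (h : HalEq E p q) : p.val H = q.val H := by
  classical
  induction h with
  | refl p => rfl
  | symm _ ih => exact ih.symm
  | trans _ _ ih ih' => exact ih.trans ih'
  | neg _ ih => simp only [HForm.val, ih]
  | inf _ _ ih ih' => simp only [HForm.val, ih, ih']
  | sup _ _ ih ih' => simp only [HForm.val, ih, ih']
  | ex x _ ih => simp only [HForm.val, ih]
  | sub s _ ih => simp only [HForm.val, ih]
  | inf_comm p q => exact Set.inter_comm _ _
  | sup_comm p q => exact Set.union_comm _ _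
  | inf_assoc p q r => exact Set.inter_assoc _ _ _
  | sup_assoc p q r => exact Set.union_assoc _ _ _
  | inf_sup_self p q => exact _root_.inf_sup_self (a := p.val H) (b := q.val H)
  | sup_inf_self p q => exact _root_.sup_inf_self (a := p.val H) (b := q.val H)
  | inf_sup_distrib p q r => exact Set.inter_union_distrib_left _ _ _
  | inf_neg p => exact Set.inter_compl_self _
  | sup_neg p => exact Set.union_compl_self _
  | ex_bot x => simp [HForm.val, cyl]
  | le_ex x p =>
    exact Set.inter_eq_left.2 fun μ hμ => ⟨μ, hμ, fun _ _ => rfl⟩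
  | ex_inf_ex x p q =>
    ext μ
    constructor
    · rintro ⟨ν, ⟨hp, ρ, hq, hρ⟩, hν⟩
      exact ⟨⟨ν, hp, hν⟩, ρ, hq, fun x' h => (hν x' h).trans (hρ x' h)⟩
    · rintro ⟨⟨ν, hp, hν⟩, ρ, hq, hρ⟩
      exact ⟨ν, ⟨hp, ρ, hq, fun x' h => (hν x' h).symm.trans (hρ x' h)⟩, hν⟩
  | @ex_comm X x y p =>
    have key : ∀ x y : X, (HForm.ex x (HForm.ex y p)).val H ⊆
        (HForm.ex y (HForm.ex x p)).val H := by
      rintro x y μ ⟨ν, ⟨ρ, hp, hρ⟩, hν⟩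
      by_cases hxy : x = y
      · subst hxy
        exact ⟨ν, ⟨ρ, hp, hρ⟩, hν⟩
      refine ⟨Point.lift E fun z => if z = y then ρ (Free.var E y) else μ (Free.var E z),
        ⟨ρ, hp, ?_⟩, ?_⟩
      · intro z hz
        rw [Point.lift_var]
        split_ifs with h
        · rw [h]
        · exact (hν z hz).trans (hρ z h)
      · intro z hz
        rw [Point.lift_var, if_neg hz]
    exact Set.Subset.antisymm (key x y) (key y x)
  | eq_refl a => exact Set.eq_univ_of_forall fun μ => rfl
  | eq_symm a b => exact Set.ext fun μ => eq_comm
  | eq_trans a b c =>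
    refine Set.inter_eq_left.2 ?_
    rintro μ ⟨h, h'⟩
    exact Eq.trans h h'
  | eq_funMap f a b =>
    refine Set.inter_eq_left.2 ?_
    intro μ hμ
    rw [HForm.mem_val_infs] at hμ
    change μ _ = μ _
    rw [FirstOrder.Language.Hom.map_fun, FirstOrder.Language.Hom.map_fun]
    refine congrArg _ (funext fun i => ?_)
    exact hμ _ ((List.mem_ofFn' _ _).2 ⟨i, rfl⟩)
  | sub_top s => rfl
  | sub_bot s => rfl
  | sub_neg s p => rfl
  | sub_inf s p q => rfl
  | sub_sup s p q => rfl
  | sub_id p => rfl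
  | sub_sub s t p => rfl
  | @sub_ex_congr X Y s t x p h =>
    have key : ∀ s t : Free E X →[L] Free E Y,
        (∀ x', x' ≠ x → s (Free.var E x') = t (Free.var E x')) →
        (HForm.sub s (HForm.ex x p)).val H ⊆ (HForm.sub t (HForm.ex x p)).val H := by
      rintro s t h μ ⟨ν, hp, hν⟩
      refine ⟨ν, hp, fun x' hx' => ?_⟩
      rw [← hν x' hx', FirstOrder.Language.Hom.comp_apply, FirstOrder.Language.Hom.comp_apply, h x' hx']
    exact Set.Subset.antisymm (key s t h) (key t s fun x' hx' => (h x' hx').symm)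
  | sub_ex s x y p hxy hs =>
    ext μ
    constructor
    · rintro ⟨ν, hp, hν⟩
      let μ' : Point E _ H :=
        Point.lift E fun z => if z = y then ν (Free.var E x) else μ (Free.var E z)
      have hμ' : ∀ z, z ≠ y → μ (Free.var E z) = μ' (Free.var E z) := fun z hz => by
        rw [Point.lift_var, if_neg hz]
      refine ⟨μ', ?_, hμ'⟩
      have : FirstOrder.Language.Hom.comp μ' s = ν := by
        refine Point.ext_var fun z => ?_
        rw [FirstOrder.Language.Hom.comp_apply]
        by_cases hz : z = x
        · rw [hz, hxy, Point.lift_var, if_pos rfl]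
        · rw [← hν z hz, FirstOrder.Language.Hom.comp_apply]
          exact (Point.eqOn_closure (S := {y' | y' ≠ y}) hμ' (hs z hz)).symm
      change FirstOrder.Language.Hom.comp μ' s ∈ p.val H
      rwa [this]
    · rintro ⟨ν, hp, hν⟩
      refine ⟨FirstOrder.Language.Hom.comp ν s, hp, fun z hz => ?_⟩
      exact Point.eqOn_closure (S := {y' | y' ≠ y}) hν (hs z hz)
  | sub_eq s a b => rfl
  | sub_inf_eq s t x a b p hs ht h =>
    refine Set.inter_eq_left.2 ?_
    rintro μ ⟨hp, hab⟩
    have : FirstOrder.Language.Hom.comp μ t = FirstOrder.Language.Hom.comp μ s := by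
      refine Point.ext_var fun z => ?_
      rw [FirstOrder.Language.Hom.comp_apply, FirstOrder.Language.Hom.comp_apply]
      by_cases hz : z = x
      · rw [hz, hs, ht]
        exact Eq.symm hab
      · rw [(h z hz).1, (h z hz).2]
    change FirstOrder.Language.Hom.comp μ t ∈ p.val H
    rw [this]
    exact hp

/-- The algebra of formulas `Φ(X)`: the domain of the sort `X` of the free Halmos algebra over
the multi-sorted set of equalities. -/
def Phi {L : FirstOrder.Language.{u, u'}} [L.IsAlgebraic] (E : Identities L) {V : Type v} (X : Finset V) :
    Type (max u v) :=
  Quot (HalEq E (X := X))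

/-- The homomorphism `Val^X_H : Φ(X) → Hal^X_Θ(H)`. -/
def Phi.val {L : FirstOrder.Language.{u, u'}} [L.IsAlgebraic] {E : Identities L} {V : Type v} {X : Finset V}
    (H : Type w) [L.Structure H] [InVariety E H] : Phi E X → Set (Point E X H) :=
  Quot.lift (HForm.val H) fun _ _ h => HalEq.val_eq H h

/-- The logical kernel of a point. -/
def LKer {L : FirstOrder.Language.{u, u'}} [L.IsAlgebraic] {E : Identities L} {V : Type v} {X : Finset V}
    {H : Type w} [L.Structure H] [InVariety E H] (μ : Point E X H) : Set (Phi E X) :=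
  {p | μ ∈ p.val H}

/-- The set of points `T^L_H`, for a set of formulas `T ⊆ Φ(X)`. -/
def elementarySet {L : FirstOrder.Language.{u, u'}} [L.IsAlgebraic] {E : Identities L} {V : Type v}
    {X : Finset V} (H : Type w) [L.Structure H] [InVariety E H] (T : Set (Phi E X)) :
    Set (Point E X H) :=
  {μ | T ⊆ LKer μ}

/-- `LG`-definable sets of points. -/
def IsLGDefinable {L : FirstOrder.Language.{u, u'}} [L.IsAlgebraic] {E : Identities L} {V : Type v}
    {X : Finset V} {H : Type w} [L.Structure H] [InVariety E H] (A : Set (Point E X H)) : Prop :=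
  ∃ T : Set (Phi E X), A = elementarySet H T

end MultiSorted

section OneSorted

/-- Pure first-order formulas with the equalities `a ≡ b`, `a, b ∈ W(V)`, as atomic formulas;
`V` is the infinite set of variables `X⁰`. -/
inductive FOForm {L : FirstOrder.Language.{u, u'}} (E : Identities L) (V : Type v) : Type (max u v)
  | eq (a b : Free E V) : FOForm E V
  | top : FOForm E V
  | bot : FOForm E V
  | neg (p : FOForm E V) : FOForm E V
  | inf (p q : FOForm E V) : FOForm E V
  | sup (p q : FOForm E V) : FOForm E V
  | ex (x : V) (p : FOForm E V) : FOForm E V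

/-- The set of points `W(V) → H` which satisfy a formula. -/
def FOForm.val {L : FirstOrder.Language.{u, u'}} [L.IsAlgebraic] {E : Identities L} {V : Type v} (H : Type w)
    [L.Structure H] : FOForm E V → Set (Point E V H)
  | .eq a b => eqSet H a b
  | .top => Set.univ
  | .bot => ∅
  | .neg p => (p.val H)ᶜ
  | .inf p q => p.val H ∩ q.val H
  | .sup p q => p.val H ∪ q.val H
  | .ex x p => cyl x (p.val H)

/-- All free occurrences of variables in the formula are occurrences of elements of `S`. -/
def FOForm.FreeVarsIn {L : FirstOrder.Language.{u, u'}} [L.IsAlgebraic] {E : Identities L} {V : Type v} :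
    FOForm E V → Set V → Prop
  | .eq a b, S =>
      a ∈ FirstOrder.Language.Substructure.closure L (Free.var E '' S) ∧
      b ∈ FirstOrder.Language.Substructure.closure L (Free.var E '' S)
  | .top, _ => True
  | .bot, _ => True
  | .neg p, S => p.FreeVarsIn S
  | .inf p q, S => p.FreeVarsIn S ∧ q.FreeVarsIn S
  | .sup p q, S => p.FreeVarsIn S ∧ q.FreeVarsIn S
  | .ex x p, S => p.FreeVarsIn (insert x S)

/-- All bound variables of the formula belong to `S`. -/
def FOForm.BoundVarsIn {L : FirstOrder.Language.{u, u'}} {E : Identities L} {V : Type v} :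
    FOForm E V → Set V → Prop
  | .eq _ _, _ => True
  | .top, _ => True
  | .bot, _ => True
  | .neg p, S => p.BoundVarsIn S
  | .inf p q, S => p.BoundVarsIn S ∧ q.BoundVarsIn S
  | .sup p q, S => p.BoundVarsIn S ∧ q.BoundVarsIn S
  | .ex x p, S => x ∈ S ∧ p.BoundVarsIn S

/-- Lindenbaum-Tarski equivalence of formulas: having the same value in every algebra of the
variety.  (The universe level `w` is a parameter; since `Type (max u v w)` contains an algebra of
every cardinality up to the number of formulas, the relation does not depend on it.) -/
def foSetoid {L : FirstOrder.Language.{u, u'}} [L.IsAlgebraic] (E : Identities L) (V : Type v) :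
    Setoid (FOForm E V) where
  r p q := ∀ (K : Type (max u v w)) [L.Structure K] [InVariety E K], p.val K = q.val K
  iseqv := ⟨fun _ _ _ _ => rfl, fun h K _ _ => (h K).symm, fun h h' K _ _ => (h K).trans (h' K)⟩

/-- Invariance of values under isomorphism. -/
theorem FOForm.mem_val_equiv {L : FirstOrder.Language.{u, u'}} [L.IsAlgebraic] {E : Identities L}
    {V : Type v} {H : Type w} {K : Type*} [L.Structure H] [L.Structure K] (e : H ≃[L] K)
    (p : FOForm E V) (η : Point E V H) :
    FirstOrder.Language.Hom.comp e.toHom η ∈ p.val K ↔ η ∈ p.val H := by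
  induction p generalizing η with
  | eq a b => exact e.injective.eq_iff
  | top => exact Iff.rfl
  | bot => exact Iff.rfl
  | neg p ih => exact not_congr (ih η)
  | inf p q ih ih' => exact and_congr (ih η) (ih' η)
  | sup p q ih ih' => exact or_congr (ih η) (ih' η)
  | ex x p ih =>
    constructor
    · rintro ⟨ν, hp, hν⟩
      have hc : FirstOrder.Language.Hom.comp e.toHom (FirstOrder.Language.Hom.comp e.symm.toHom ν) = ν := by
        apply FirstOrder.Language.Hom.ext
        intro a
        exact e.apply_symm_apply (ν a)
      refine ⟨FirstOrder.Language.Hom.comp e.symm.toHom ν, (ih _).1 (by rwa [hc]), fun y hy => ?_⟩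
      apply e.injective
      refine (hν y hy).trans ?_
      exact (e.apply_symm_apply _).symm
    · rintro ⟨ν, hp, hν⟩
      exact ⟨FirstOrder.Language.Hom.comp e.toHom ν, (ih _).2 hp, fun y hy => congrArg e (hν y hy)⟩

theorem InVariety.of_equiv {L : FirstOrder.Language.{u, u'}} {E : Identities L} {H : Type w} {K : Type*}
    [L.Structure H] [L.Structure K] [InVariety E H] (e : H ≃[L] K) : InVariety E K where
  sat p hp a := by
    have ha : a = e ∘ fun n => e.symm (a n) := funext fun n => (e.apply_symm_apply (a n)).symm
    rw [ha, FirstOrder.Language.HomClass.realize_term, FirstOrder.Language.HomClass.realize_term,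
      InVariety.sat p hp]

/-- The algebra of formulas `Φ(X⁰)`. -/
def Phi0 {L : FirstOrder.Language.{u, u'}} [L.IsAlgebraic] (E : Identities L) (V : Type v) :
    Type (max u v) :=
  Quotient (foSetoid.{u, u', v, w} E V)

/-- The element of `Φ(X⁰)` represented by a pure formula. -/
def Phi0.mk {L : FirstOrder.Language.{u, u'}} [L.IsAlgebraic] {E : Identities L} {V : Type v}
    (p : FOForm E V) : Phi0.{u, u', v, w} E V :=
  Quotient.mk (foSetoid.{u, u', v, w} E V) p

/-- `Val^{X⁰}_H(p)`: the set of points `W(X⁰) → H` which satisfy `p ∈ Φ(X⁰)`. -/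
def Phi0.val {L : FirstOrder.Language.{u, u'}} [L.IsAlgebraic] {E : Identities L} {V : Type v} (H : Type w)
    [L.Structure H] [InVariety E H] : Phi0.{u, u', v, w} E V → Set (Point E V H) :=
  Quotient.lift (FOForm.val H) fun p q h => by
    let e₀ : H ≃ ULift.{max u v} H := Equiv.ulift.symm
    let : L.Structure (ULift.{max u v} H) := e₀.inducedStructure
    let e : H ≃[L] ULift.{max u v} H := e₀.inducedStructureEquiv
    have : InVariety E (ULift.{max u v} H) := InVariety.of_equiv e
    ext η
    rw [← FOForm.mem_val_equiv e p, ← FOForm.mem_val_equiv e q, h (ULift.{max u v} H)]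

/-- Conjunction in the Boolean algebra `Φ(X⁰)`. -/
def Phi0.inf {L : FirstOrder.Language.{u, u'}} [L.IsAlgebraic] {E : Identities L} {V : Type v} :
    Phi0.{u, u', v, w} E V → Phi0.{u, u', v, w} E V → Phi0.{u, u', v, w} E V :=
  Quotient.map₂ FOForm.inf fun p p' hp q q' hq K _ _ => by
    simp only [FOForm.val, hp K, hq K]

/-- Finite conjunctions in `Φ(X⁰)`. -/
def Phi0.infs {L : FirstOrder.Language.{u, u'}} [L.IsAlgebraic] {E : Identities L} {V : Type v} :
    List (Phi0.{u, u', v, w} E V) → Phi0.{u, u', v, w} E V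
  | [] => Phi0.mk FOForm.top
  | p :: l => Phi0.inf p (Phi0.infs l)

/-- `X`-special formulas: elements of `Φ(X⁰)` represented by a formula with all free variables
in `X` and all bound variables in `Y⁰ = X⁰ \ X`. -/
def IsSpecial {L : FirstOrder.Language.{u, u'}} [L.IsAlgebraic] {E : Identities L} {V : Type v}
    (X : Finset V) (p : Phi0.{u, u', v, w} E V) : Prop :=
  ∃ q : FOForm E V, Phi0.mk q = p ∧ q.FreeVarsIn (X : Set V) ∧ q.BoundVarsIn (X : Set V)ᶜ

/-- The elementary theory of `H` in `Φ(X⁰)`. -/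
def theory {L : FirstOrder.Language.{u, u'}} [L.IsAlgebraic] (E : Identities L) (V : Type v) (H : Type w)
    [L.Structure H] [InVariety E H] : Set (Phi0.{u, u', v, w} E V) :=
  {p | p.val H = Set.univ}

/-- `T` is consistent with the elementary theory of `H`: no finite conjunction of elements of
`T ∪ Th(H)` is the zero of `Φ(X⁰)`. -/
def ConsistentWith {L : FirstOrder.Language.{u, u'}} [L.IsAlgebraic] {E : Identities L} {V : Type v}
    (H : Type w) [L.Structure H] [InVariety E H] (T : Set (Phi0.{u, u', v, w} E V)) : Prop :=
  ∀ l : List (Phi0.{u, u', v, w} E V), (∀ p ∈ l, p ∈ T ∪ theory E V H) →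
    Phi0.infs l ≠ Phi0.mk FOForm.bot

/-- `X`-types (`X`-`MT`-types) over `H`: sets of `X`-special formulas which are consistent with
the elementary theory of `H`. -/
structure IsXType {L : FirstOrder.Language.{u, u'}} [L.IsAlgebraic] {E : Identities L} {V : Type v}
    (H : Type w) [L.Structure H] [InVariety E H] (X : Finset V)
    (T : Set (Phi0.{u, u', v, w} E V)) : Prop where
  special : ∀ p ∈ T, IsSpecial X p
  consistent : ConsistentWith H T

/-- The type `Tp^H(μ)` of a point: the set of all `X`-special formulas
`p(x₁,…,xₙ; y₁,…,yₘ)` such that the closed formula `p(μ x₁,…,μ xₙ; y₁,…,yₘ)` is satisfied in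
`H`, that is, such that `p` is satisfied by all `η : W(X⁰) → H` with `η x = μ x` for `x ∈ X`. -/
def Tp {L : FirstOrder.Language.{u, u'}} [L.IsAlgebraic] {E : Identities L} {V : Type v} {X : Finset V}
    {H : Type w} [L.Structure H] [InVariety E H] (μ : Point E X H) :
    Set (Phi0.{u, u', v, w} E V) :=
  {p | IsSpecial X p ∧
    ∀ η : Point E V H, (∀ x : X, η (Free.var E (x : V)) = μ (Free.var E x)) → η ∈ p.val H}

/-- The set of points `T^{L₀}_H`, for an `X`-type `T`. -/
def typeSet {L : FirstOrder.Language.{u, u'}} [L.IsAlgebraic] {E : Identities L} {V : Type v}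
    {X : Finset V} (H : Type w) [L.Structure H] [InVariety E H]
    (T : Set (Phi0.{u, u', v, w} E V)) : Set (Point E X H) :=
  {μ | T ⊆ Tp μ}

/-- `MT`-definable sets of points. -/
def IsMTDefinable {L : FirstOrder.Language.{u, u'}} [L.IsAlgebraic] {E : Identities L} {V : Type v}
    {X : Finset V} {H : Type w} [L.Structure H] [InVariety E H] (A : Set (Point E X H)) : Prop :=
  ∃ T : Set (Phi0.{u, u', v, w} E V), IsXType H X T ∧ A = typeSet H T

end OneSorted

end LogicalGeometry

/-! Both kinds of definability come from a Galois connection between sets of formulas and sets of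
points, so it suffices to show that over `H` the formulas of sort `X` and the `X`-special formulas
cut out the same conditions on points. The two kinds of points are compared by restriction:
`Free.incl X` embeds the variables of `X` in `V`, and a point `η` over `V` restricts to `η ∘ incl`
over `X`. Since `H` is nonempty, every point over `X` is such a restriction
(`Point.exists_extension`).

The translation goes both ways. `FOForm.exists_hForm` turns a first-order formula with free
variables in `X` into a formula of sort `X`: a quantified variable is added to the sort, bound
there, and then removed by some `s_*`. This needs a homomorphism back to `W(X)`, hence the
assumption that `X` is nonempty; for empty `X` there is only one point, and
`IsLGDefinable.of_isEmpty` settles that case directly. `HForm.exists_foForm` turns a formula of sort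
`X` into an `X`-special one: all substitutions are pushed down to the equalities, and each
quantifier is given a fresh variable, available because `V` is infinite.

Given a definable set `A`, take all formulas of the other kind that hold throughout `A`. A point
satisfying all of them satisfies the translations of the formulas defining `A`, so it lies in `A`.
In the direction from `LG` to `MT` the chosen set must also be a type, and a point of `A`, extended
to `V`, witnesses its consistency; this is where nonemptiness of `A` enters. -/

namespace LogicalGeometry

/-! ### Free algebras, inclusions of variables and extension of points -/

section FreeAlgebra

variable {L : FirstOrder.Language.{u, u'}} [L.IsAlgebraic] {E : Identities L}

/-- This makes every instance of an identity in the free algebra a generator of `TermCongr`.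
Membership of the free algebra in the variety is then what allows `Point.lift` to build
homomorphisms between free algebras. -/
theorem Free.realize_mk {α : Type*} {β : Type v} (σ : α → L.Term β) (t : L.Term α) :
    t.realize (fun i => Free.mk E (σ i)) = Free.mk E (t.subst σ) := by
  induction t with
  | var x => rfl
  | func f t ih =>
    rw [FirstOrder.Language.Term.realize_func, funext ih, Free.funMap_mk]
    rfl

/-- The free algebra of the variety belongs to the variety. -/
instance Free.inVariety (α : Type v) : InVariety E (Free E α) where
  sat p hp a := by
    obtain ⟨σ, rfl⟩ : ∃ σ : ℕ → L.Term α, a = fun i => Free.mk E (σ i) :=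
      ⟨fun i => Quotient.out (a i), funext fun i => (Quotient.out_eq (a i)).symm⟩
    rw [Free.realize_mk, Free.realize_mk]
    exact Quotient.sound (s := termSetoid E α) (TermCongr.ident p hp σ)

/-- The values of a homomorphism of a free algebra lie in every subalgebra that contains the
values of the variables. -/
theorem Point.mem_of_var_mem {α : Type v} {H : Type w} [L.Structure H] (μ : Point E α H)
    (S : L.Substructure H) (h : ∀ x, μ (Free.var E x) ∈ S) (a : Free E α) : μ a ∈ S := by
  obtain ⟨t, rfl⟩ : ∃ t, Free.mk E t = a := Quotient.exists_rep a
  induction t with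
  | var x => exact h x
  | func f t ih =>
    rw [← Free.funMap_mk, FirstOrder.Language.Hom.map_fun]
    exact S.fun_mem f _ ih

/-- The homomorphism `W(X) → W(V)` that extends the inclusion `X ⊆ V`. -/
noncomputable def Free.incl {V : Type v} (X : Finset V) : Free E X →[L] Free E V :=
  Point.lift E fun x : X => Free.var E (x : V)

theorem Free.incl_mem_closure {V : Type v} (X : Finset V) (a : Free E X) :
    Free.incl X a ∈
      FirstOrder.Language.Substructure.closure L (Free.var E '' (X : Set V)) := by
  refine Point.mem_of_var_mem (Free.incl X) _ (fun x => ?_) a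
  rw [Free.incl, Point.lift_var]
  exact FirstOrder.Language.Substructure.subset_closure (Set.mem_image_of_mem _ x.2)

/-- The range of `Free.incl X` is a subalgebra containing the generators. It lets equalities between
elements generated by `X` be read as equalities in `W(X)`. -/
theorem Free.exists_incl_eq {V : Type v} (X : Finset V) {a : Free E V}
    (ha : a ∈ FirstOrder.Language.Substructure.closure L (Free.var E '' (X : Set V))) :
    ∃ b : Free E X, Free.incl X b = a := by
  suffices h : FirstOrder.Language.Substructure.closure L (Free.var E '' (X : Set V)) ≤
      (Free.incl (E := E) X).range from h ha
  rw [FirstOrder.Language.Substructure.closure_le]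
  rintro _ ⟨x, hx, rfl⟩
  exact ⟨Free.var E ⟨x, hx⟩, rfl⟩

theorem Point.comp_incl_eq_iff {V : Type v} {X : Finset V} {H : Type w} [L.Structure H]
    {η : Point E V H} {μ : Point E X H} :
    FirstOrder.Language.Hom.comp η (Free.incl X) = μ ↔
      ∀ x : X, η (Free.var E (x : V)) = μ (Free.var E x) := by
  refine ⟨?_, fun h => Point.ext_var h⟩
  rintro rfl x
  rfl

/-- A point over `X` extends to a point over `V` that takes prescribed values outside `X`. -/
theorem Point.exists_extension {V : Type v} {X : Finset V} {H : Type w} [L.Structure H]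
    [InVariety E H] (μ : Point E X H) (f : V → H) :
    ∃ η : Point E V H, FirstOrder.Language.Hom.comp η (Free.incl X) = μ ∧
      ∀ x ∉ X, η (Free.var E x) = f x := by
  classical
  refine ⟨Point.lift E fun x => if h : x ∈ X then μ (Free.var E ⟨x, h⟩) else f x,
    Point.comp_incl_eq_iff.2 fun x => ?_, fun x hx => ?_⟩
  · rw [Point.lift_var, dif_pos x.2]
  · rw [Point.lift_var, dif_neg hx]

end FreeAlgebra

/-! ### Translations between first-order formulas and formulas of a finite sort -/

section Translations

theorem FOForm.BoundVarsIn.mono {L : FirstOrder.Language.{u, u'}} {E : Identities L} {V : Type v}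
    {S S' : Set V} (h : S ⊆ S') {p : FOForm E V}
    (hp : p.BoundVarsIn S) : p.BoundVarsIn S' := by
  induction p with
  | eq a b => trivial
  | top => trivial
  | bot => trivial
  | neg p ih => exact ih hp
  | inf p q ih ih' => exact ⟨ih hp.1, ih' hp.2⟩
  | sup p q ih ih' => exact ⟨ih hp.1, ih' hp.2⟩
  | ex x p ih => exact ⟨h hp.1, ih hp.2⟩

variable {L : FirstOrder.Language.{u, u'}} [L.IsAlgebraic] {E : Identities L} {V : Type v}

/-- Every first-order formula with free variables in a nonempty finite set `X` is equivalent
over `H` to a formula of the sort `X`. -/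
theorem FOForm.exists_hForm (H : Type w) [L.Structure H] [InVariety E H] (p : FOForm E V)
    {X : Finset V} (hX : X.Nonempty) (hp : p.FreeVarsIn (X : Set V)) :
    ∃ u : HForm E X, ∀ η : Point E V H,
      η ∈ p.val H ↔ FirstOrder.Language.Hom.comp η (Free.incl X) ∈ u.val H := by
  classical
  induction p generalizing X with
  | eq a b =>
    obtain ⟨a, rfl⟩ := Free.exists_incl_eq X hp.1
    obtain ⟨b, rfl⟩ := Free.exists_incl_eq X hp.2
    exact ⟨.eq a b, fun η => Iff.rfl⟩
  | top => exact ⟨.top, fun η => Iff.rfl⟩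
  | bot => exact ⟨.bot, fun η => Iff.rfl⟩
  | neg p ih =>
    obtain ⟨u, hu⟩ := ih hX hp
    exact ⟨.neg u, fun η => not_congr (hu η)⟩
  | inf p q ih ih' =>
    obtain ⟨u, hu⟩ := ih hX hp.1
    obtain ⟨u', hu'⟩ := ih' hX hp.2
    exact ⟨.inf u u', fun η => and_congr (hu η) (hu' η)⟩
  | sup p q ih ih' =>
    obtain ⟨u, hu⟩ := ih hX hp.1
    obtain ⟨u', hu'⟩ := ih' hX hp.2
    exact ⟨.sup u u', fun η => or_congr (hu η) (hu' η)⟩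
  | ex x p ih =>
    have hp' : p.FreeVarsIn ((insert x X : Finset V) : Set V) := by
      rw [Finset.coe_insert]
      exact hp
    obtain ⟨u, hu⟩ := ih (Finset.insert_nonempty x X) hp'
    obtain ⟨z, hz⟩ := hX
    let x' : (insert x X : Finset V) := ⟨x, Finset.mem_insert_self x X⟩
    -- Only the variables other than `x` matter, because `s_*` is applied to a formula quantified
    -- over `x`. The value `z` for `x ∉ X` is arbitrary; without some element of `W(X)` no such
    -- homomorphism would exist. The case `x ∈ X` is covered as well.
    let s : Free E (insert x X : Finset V) →[L] Free E X := Point.lift E fun y =>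
      if h : (y : V) ∈ X then Free.var E ⟨y, h⟩ else Free.var E ⟨z, hz⟩
    have hs : ∀ (η : Point E V H) (y : (insert x X : Finset V)), y ≠ x' →
        FirstOrder.Language.Hom.comp (FirstOrder.Language.Hom.comp η (Free.incl X)) s
          (Free.var E y) = η (Free.var E (y : V)) := by
      intro η y hy
      have hyX : (y : V) ∈ X :=
        (Finset.mem_insert.1 y.2).resolve_left fun h => hy (Subtype.ext h)
      rw [FirstOrder.Language.Hom.comp_apply, Point.lift_var, dif_pos hyX]
      rfl
    refine ⟨.sub s (.ex x' u), fun η => ⟨?_, ?_⟩⟩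
    · rintro ⟨ν, hν, h⟩
      refine ⟨FirstOrder.Language.Hom.comp ν (Free.incl _), (hu ν).1 hν, fun y hy => ?_⟩
      rw [hs η y hy]
      exact h y fun h => hy (Subtype.ext h)
    · rintro ⟨ν, hν, h⟩
      -- Outside `insert x X` the extension copies `η`, so `ν'` differs from `η` at most at `x`, as
      -- the quantifier over all of `V` demands.
      obtain ⟨ν', rfl, hν'⟩ := Point.exists_extension ν fun y => η (Free.var E y)
      refine ⟨ν', (hu ν').2 hν, fun y hy => ?_⟩
      by_cases hyX : y ∈ insert x X
      · have := h ⟨y, hyX⟩ fun h => hy (congrArg Subtype.val h)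
        rw [hs η _ fun h => hy (congrArg Subtype.val h)] at this
        exact this
      · exact (hν' y hyX).symm

/-- For a formula `u` of the sort `Y` and a homomorphism `s` of `W(Y)` into the subalgebra
generated by a finite set `X` of variables, `s_* u` is equivalent over `H` to a first-order
formula with free variables in `X` and bound variables outside `X`. -/
theorem HForm.exists_foForm [Infinite V] (H : Type w) [L.Structure H] [InVariety E H]
    {Y : Finset V} (u : HForm E Y) (s : Free E Y →[L] Free E V) (X : Finset V)
    (hs : ∀ a, s a ∈
      FirstOrder.Language.Substructure.closure L (Free.var E '' (X : Set V))) :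
    ∃ p : FOForm E V, p.FreeVarsIn (X : Set V) ∧ p.BoundVarsIn (X : Set V)ᶜ ∧
      ∀ η : Point E V H, η ∈ p.val H ↔ FirstOrder.Language.Hom.comp η s ∈ u.val H := by
  classical
  induction u generalizing X with
  | eq a b => exact ⟨.eq (s a) (s b), ⟨hs a, hs b⟩, trivial, fun η => Iff.rfl⟩
  | top => exact ⟨.top, trivial, trivial, fun η => Iff.rfl⟩
  | bot => exact ⟨.bot, trivial, trivial, fun η => Iff.rfl⟩
  | neg u ih =>
    obtain ⟨p, hf, hb, hp⟩ := ih s X hs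
    exact ⟨.neg p, hf, hb, fun η => not_congr (hp η)⟩
  | inf u u' ih ih' =>
    obtain ⟨p, hf, hb, hp⟩ := ih s X hs
    obtain ⟨p', hf', hb', hp'⟩ := ih' s X hs
    exact ⟨.inf p p', ⟨hf, hf'⟩, ⟨hb, hb'⟩, fun η => and_congr (hp η) (hp' η)⟩
  | sup u u' ih ih' =>
    obtain ⟨p, hf, hb, hp⟩ := ih s X hs
    obtain ⟨p', hf', hb', hp'⟩ := ih' s X hs
    exact ⟨.sup p p', ⟨hf, hf'⟩, ⟨hb, hb'⟩, fun η => or_congr (hp η) (hp' η)⟩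
  | sub t u ih =>
    -- The operation `t_*` is absorbed into the homomorphism; the induction is over arbitrary `s`
    -- for this reason.
    exact ih (FirstOrder.Language.Hom.comp s t) X fun a => hs (t a)
  | @ex Y y u ih =>
    -- The bound variable `y` is renamed to a fresh `z`. Since the values of `s` involve only
    -- variables of `X`, none of them is captured by `∃z`.
    obtain ⟨z, hz⟩ := Infinite.exists_notMem_finset X
    let t : Free E Y →[L] Free E V :=
      Point.lift E fun y' => if y' = y then Free.var E z else s (Free.var E y')
    have ht : t (Free.var E y) = Free.var E z := by
      rw [Point.lift_var, if_pos rfl]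
    have ht' : ∀ y', y' ≠ y → t (Free.var E y') = s (Free.var E y') := fun y' h => by
      rw [Point.lift_var, if_neg h]
    have htm : ∀ a, t a ∈ FirstOrder.Language.Substructure.closure L
        (Free.var E '' ((insert z X : Finset V) : Set V)) := by
      refine Point.mem_of_var_mem t _ fun y' => ?_
      by_cases h : y' = y
      · rw [h, ht]
        exact FirstOrder.Language.Substructure.subset_closure
          ⟨z, Finset.mem_coe.2 (Finset.mem_insert_self z X), rfl⟩
      · rw [ht' y' h]
        refine FirstOrder.Language.Substructure.closure_mono (Set.image_mono ?_) (hs _)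
        exact Finset.coe_subset.2 (Finset.subset_insert z X)
    have hagree : ∀ (η ν : Point E V H), (∀ x, x ≠ z → η (Free.var E x) = ν (Free.var E x)) →
        ∀ a, η (s a) = ν (s a) := fun η ν h a =>
      Point.eqOn_closure (S := (X : Set V)) (fun x hx => h x fun hxz => hz (hxz ▸ hx)) (hs a)
    -- Enlarging the set to `insert z X` lets `z` be free in `p`; it also keeps the inner bound
    -- variables outside `X`.
    obtain ⟨p, hf, hb, hp⟩ := ih t (insert z X) htm
    rw [Finset.coe_insert] at hf hb
    refine ⟨.ex z p, hf, ⟨hz, hb.mono ?_⟩, fun η => ⟨?_, ?_⟩⟩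
    · exact Set.compl_subset_compl.2 (Set.subset_insert _ _)
    · rintro ⟨ν, hν, h⟩
      refine ⟨FirstOrder.Language.Hom.comp ν t, (hp ν).1 hν, fun y' hy' => ?_⟩
      rw [FirstOrder.Language.Hom.comp_apply, FirstOrder.Language.Hom.comp_apply, ht' y' hy']
      exact hagree η ν h _
    · rintro ⟨ν, hν, h⟩
      -- The value that `ν` gives to `y` is moved to `z`. Changing `η` at `z` does not affect the
      -- values on the range of `s`, so `ν' ∘ t = ν`.
      let ν' : Point E V H :=
        Point.lift E fun x => if x = z then ν (Free.var E y) else η (Free.var E x)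
      have hν' : ∀ x, x ≠ z → η (Free.var E x) = ν' (Free.var E x) := fun x hx => by
        rw [Point.lift_var, if_neg hx]
      refine ⟨ν', (hp ν').2 ?_, hν'⟩
      have : FirstOrder.Language.Hom.comp ν' t = ν := by
        refine Point.ext_var fun y' => ?_
        rw [FirstOrder.Language.Hom.comp_apply]
        by_cases hy' : y' = y
        · rw [hy', ht, Point.lift_var, if_pos rfl]
        · rw [ht' y' hy', ← hagree η ν' hν', ← h y' hy']
          rfl
      rwa [this]

end Translations

/-! ### Comparison of the two notions of definability -/

section Definability

variable {L : FirstOrder.Language.{u, u'}} [L.IsAlgebraic] {E : Identities L} {V : Type v}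

theorem Phi0.val_inf (H : Type w) [L.Structure H] [InVariety E H]
    (p q : Phi0.{u, u', v, w} E V) : (Phi0.inf p q).val H = p.val H ∩ q.val H := by
  induction p using Quotient.inductionOn
  induction q using Quotient.inductionOn
  rfl

theorem Phi0.mem_val_infs (H : Type w) [L.Structure H] [InVariety E H] (η : Point E V H)
    {l : List (Phi0.{u, u', v, w} E V)} (h : ∀ p ∈ l, η ∈ p.val H) :
    η ∈ (Phi0.infs l).val H := by
  induction l with
  | nil => trivial
  | cons p l ih =>
    rw [Phi0.infs, Phi0.val_inf]
    exact ⟨h p List.mem_cons_self, ih fun q hq => h q (List.mem_cons_of_mem p hq)⟩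

/-- A set of formulas which is satisfied by some point is consistent with the theory of `H`. -/
theorem ConsistentWith.of_mem_val {H : Type w} [L.Structure H] [InVariety E H]
    {T : Set (Phi0.{u, u', v, w} E V)} (η : Point E V H) (h : ∀ p ∈ T, η ∈ p.val H) :
    ConsistentWith H T := by
  intro l hl hbot
  have hη : η ∈ (Phi0.infs l).val H := Phi0.mem_val_infs H η fun p hp =>
    (hl p hp).elim (h p) fun hth => by
      rw [show p.val H = Set.univ from hth]
      trivial
  rw [hbot] at hη
  exact hη

/-- `Tp` quantifies over all extensions of a point to `V`, and `η` is one extension of its own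
restriction. -/
theorem Tp.mem_val {X : Finset V} {H : Type w} [L.Structure H] [InVariety E H]
    {η : Point E V H} {p : Phi0.{u, u', v, w} E V}
    (hp : p ∈ Tp (FirstOrder.Language.Hom.comp η (Free.incl X))) : η ∈ p.val H :=
  hp.2 η fun _ => rfl

/-- Over the empty set of variables there is a single point, and every set of points is
`LG`-definable. -/
theorem IsLGDefinable.of_isEmpty {H : Type w} [L.Structure H] [InVariety E H] {X : Finset V}
    (hX : ¬X.Nonempty) (A : Set (Point E X H)) : IsLGDefinable A := by
  have hsub : ∀ μ ν : Point E X H, μ = ν := fun μ ν =>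
    Point.ext_var fun x => absurd ⟨x, x.2⟩ hX
  by_cases hA : A.Nonempty
  · obtain ⟨ν, hν⟩ := hA
    refine ⟨∅, Set.ext fun μ => ⟨fun _ => Set.empty_subset _, fun _ => ?_⟩⟩
    rwa [hsub μ ν]
  · refine ⟨{Quot.mk _ HForm.bot}, Set.ext fun μ => ⟨fun h => absurd ⟨μ, h⟩ hA, fun h => ?_⟩⟩
    -- A point in the set defined by `bot` would belong to the empty value of `bot`.
    exact False.elim (h rfl)

/-- The defining set is the full `LG`-theory of `A`. Each member of the type `T` translates to a
formula of sort `X` in that theory. -/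
theorem IsMTDefinable.isLGDefinable {H : Type w} [L.Structure H] [Nonempty H] [InVariety E H]
    {X : Finset V} {A : Set (Point E X H)} (hA : IsMTDefinable A) : IsLGDefinable A := by
  by_cases hX : X.Nonempty
  swap
  · exact IsLGDefinable.of_isEmpty hX A
  obtain ⟨T, hT, rfl⟩ := hA
  refine ⟨{u | ∀ μ ∈ typeSet H T, u ∈ LKer μ}, Set.Subset.antisymm (fun μ hμ u hu => hu μ hμ)
    fun μ hμ p hpT => ⟨hT.special p hpT, fun η hη => ?_⟩⟩
  obtain ⟨q, rfl, hq, -⟩ := hT.special p hpT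
  obtain ⟨u, hu⟩ := q.exists_hForm H hX hq
  have hmem : μ ∈ u.val H := by
    -- It has to be seen that `u` holds at every `μ'` realizing `T`. An extension of `μ'` to `V`
    -- satisfies the formula `q`, and the translation carries this back to `μ'`.
    refine hμ (a := Quot.mk _ u) fun μ' hμ' => ?_
    obtain ⟨η', rfl, -⟩ := Point.exists_extension μ' fun _ => Classical.arbitrary H
    exact (hu η').1 (Tp.mem_val (hμ' hpT))
  -- The translation depends only on the restriction of `η` to `X`, so truth at `μ` gives truth at
  -- every extension, as `Tp` requires.
  rw [← Point.comp_incl_eq_iff.2 hη] at hmem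
  exact (hu η).2 hmem

/-- The type is the intersection of the types of all points of `A`. The point `μ₀` makes its members
special and, through an extension to `V` satisfying all of them, consistent with the theory of `H`.
-/
theorem IsLGDefinable.isMTDefinable [Infinite V] {H : Type w} [L.Structure H] [Nonempty H]
    [InVariety E H] {X : Finset V} {A : Set (Point E X H)} (hne : A.Nonempty)
    (hA : IsLGDefinable A) : IsMTDefinable A := by
  obtain ⟨T, rfl⟩ := hA
  obtain ⟨μ₀, hμ₀⟩ := hne
  refine ⟨{p | ∀ μ ∈ elementarySet H T, p ∈ Tp μ}, ⟨fun p hp => (hp μ₀ hμ₀).1, ?_⟩,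
    Set.Subset.antisymm (fun μ hμ p hp => hp μ hμ) fun μ hμ u huT => ?_⟩
  · obtain ⟨η, rfl, -⟩ := Point.exists_extension μ₀ fun _ => Classical.arbitrary H
    exact ConsistentWith.of_mem_val η fun p hp => Tp.mem_val (hp _ hμ₀)
  · obtain ⟨u, rfl⟩ := Quot.exists_rep u
    -- The translation is applied with the inclusion of variables as homomorphism, so `p` is
    -- `X`-special and says of `η` what `u` says of its restriction.
    obtain ⟨p, hf, hb, hp⟩ := u.exists_foForm H (Free.incl X) X (Free.incl_mem_closure X)
    have hmem : Phi0.mk p ∈ Tp μ := by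
      refine hμ fun μ' hμ' => ⟨⟨p, rfl, hf, hb⟩, fun η hη => (hp η).2 ?_⟩
      rw [Point.comp_incl_eq_iff.2 hη]
      exact hμ' huT
    obtain ⟨η, rfl, -⟩ := Point.exists_extension μ fun _ => Classical.arbitrary H
    exact (hp η).1 (Tp.mem_val hmem)

end Definability

end LogicalGeometry

theorem theorem3p14 {L : FirstOrder.Language.{u, u'}} [L.IsAlgebraic] (E : LogicalGeometry.Identities L)
    {V : Type v} [Infinite V] (H : Type w) [L.Structure H] [Nonempty H] [LogicalGeometry.InVariety E H]
    (X : Finset V) (A : Set (LogicalGeometry.Point E X H)) :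
    (LogicalGeometry.IsMTDefinable A → LogicalGeometry.IsLGDefinable A) ∧ (A.Nonempty → LogicalGeometry.IsLGDefinable A → LogicalGeometry.IsMTDefinable A) :=
  ⟨fun h => h.isLGDefinable, fun hne h => h.isMTDefinable hne⟩
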